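/- Let $\Sigma$ be an alphabet and let $a,b,c\in\Sigma$ be three distinct letters. A grammar over $\Sigma$ has a finite set of rules $A\to X_1\ldots X_\ell$ with $\ell\ge 0$, where $A$ is a nonterminal and each $X_i$ is a letter or a nonterminal; it is linear if every right-hand side contains at most one nonterminal, and unambiguous if every word has at most one parse tree (rooted in the initial nonterminal). A grammar in which every word has only finitely many parse trees, regarded as a GF(2)-grammar, describes the language of all words with an odd number of parse trees. For $K,L\subseteq\Sigma^*$, the GF(2)-concatenation $K\odot L$ is the set of all $w\in\Sigma^*$ for which the number of pairs $(u,v)\in K\times L$ with $uv=w$ is odd. Theorem. The languages $L_1=\{a^nb^n\mid n\ge 0\}$ and $L_2=\{b^mc^m\mid m\ge 0\}$ are generated by unambiguous linear grammars. Their GF(2)-concatenation is $L_1\odot L_2=\{a^nb^{n+m}c^m\mid n\ge 0,\ m\ge 0\}$, and this language is not described by any linear GF(2)-grammar. Hence the family of languages over $\Sigma$ described by linear GF(2)-grammars is not closed under GF(2)-concatenation: there are $K,L\subseteq\Sigma^*$, each described by a linear GF(2)-grammar, such that $K\odot L$ is not described by any linear GF(2)-grammar. -/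

import Mathlib

/-!
Linear GF(2)-grammars over Mathlib's `ContextFreeGrammar`: a (GF(2)-)grammar has finitely many
rules `A → X₁ … Xₗ`, and a GF(2)-grammar describes the words with an odd number of parse trees.
-/

/-- A finite ordered sequence of trees whose leaves carry terminals and whose inner vertices carry
grammar rules. `nil` is the empty sequence; `leaf t rest` is a one-vertex tree labelled with the
terminal `t`, followed by the sequence `rest`; `node r children rest` is a tree with a root where
the rule `r` is applied and whose sequence of immediate subtrees is `children`, followed by the
sequence `rest`. -/
inductive ParseForest (T N : Type*) where
  | nil : ParseForest T N
  | leaf (t : T) (rest : ParseForest T N) : ParseForest T N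
  | node (r : ContextFreeRule T N) (children rest : ParseForest T N) : ParseForest T N

namespace ParseForest

/-- The sequence of the symbols at the roots of the trees. -/
def roots {T N : Type*} : ParseForest T N → List (Symbol T N)
  | nil => []
  | leaf t rest => Symbol.terminal t :: rest.roots
  | node r _ rest => Symbol.nonterminal r.input :: rest.roots

/-- The string formed by the leaves, read from left to right. -/
def yield {T N : Type*} : ParseForest T N → List T
  | nil => []
  | leaf t rest => t :: rest.yield
  | node _ children rest => children.yield ++ rest.yield

/-- Every inner vertex applies a rule from the set `R`, and the symbols at its children are exactly
the right-hand side of that rule. -/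
def WellFormed {T N : Type*} (R : Set (ContextFreeRule T N)) : ParseForest T N → Prop
  | nil => True
  | leaf _ rest => rest.WellFormed R
  | node r children rest =>
      r ∈ R ∧ children.roots = r.output ∧ children.WellFormed R ∧ rest.WellFormed R

end ParseForest

namespace ContextFreeGrammar

/-- The set of all parse trees of the word `w` in the grammar `g`
(a tree is a sequence of trees with exactly one root). -/
def parseTrees {T : Type*} (g : ContextFreeGrammar T) (w : List T) : Set (ParseForest T g.NT) :=
  {F | F.WellFormed {r | r ∈ g.rules} ∧ F.roots = [Symbol.nonterminal g.initial] ∧ F.yield = w}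

/-- A grammar is linear if every rule has the form `A → w` or `A → u B v`, with words `u`, `v`, `w`
over the terminals and a nonterminal `B`. -/
def IsLinear {T : Type*} (g : ContextFreeGrammar T) : Prop :=
  ∀ r ∈ g.rules,
    (∃ w : List T, r.output = w.map Symbol.terminal) ∨
    (∃ (u v : List T) (B : g.NT),
      r.output = u.map Symbol.terminal ++ [Symbol.nonterminal B] ++ v.map Symbol.terminal)

/-- A grammar is unambiguous if every word has at most one parse tree. -/
def IsUnambiguous {T : Type*} (g : ContextFreeGrammar T) : Prop :=
  ∀ w : List T, (g.parseTrees w).Subsingleton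

/-- A grammar is a legitimate GF(2)-grammar if every word has only finitely many parse trees. -/
def IsGF2Grammar {T : Type*} (g : ContextFreeGrammar T) : Prop :=
  ∀ w : List T, (g.parseTrees w).Finite

/-- The language described by `g` as a GF(2)-grammar: all words with an odd number of parse
trees. -/
def gf2Language {T : Type*} (g : ContextFreeGrammar T) : Language T :=
  {w : List T | Odd (g.parseTrees w).ncard}

end ContextFreeGrammar

namespace Language

/-- `L` is generated by an unambiguous linear (ordinary) grammar. -/
def IsUnambiguousLinear {T : Type*} (L : Language T) : Prop :=
  ∃ g : ContextFreeGrammar T, g.IsLinear ∧ g.IsUnambiguous ∧ g.language = L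

/-- `L` is described by a linear GF(2)-grammar. -/
def IsLinearGF2 {T : Type*} (L : Language T) : Prop :=
  ∃ g : ContextFreeGrammar T, g.IsLinear ∧ g.IsGF2Grammar ∧ g.gf2Language = L

/-- GF(2)-concatenation `K ⊙ L`: all words `w` with an odd number of representations `w = uv`,
`u ∈ K`, `v ∈ L` (every word has only finitely many representations `w = uv`). -/
def gf2Concat {T : Type*} (K L : Language T) : Language T :=
  {w : List T | Odd {p : List T × List T | p.1 ∈ K ∧ p.2 ∈ L ∧ p.1 ++ p.2 = w}.ncard}

/-- The language `{aⁿ bⁿ | n ≥ 0}`. -/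
def anbn {T : Type*} (a b : T) : Language T :=
  {w : List T | ∃ n : ℕ, w = List.replicate n a ++ List.replicate n b}

end Language

/-! Fix a linear GF(2)-grammar. For a nonterminal `A`, record the parities of the numbers of parse
trees of `aⁱbʲcᵏ` in a power series `f_A` whose two variables mark `i` and `k` and whose
coefficients are functions of `j`. When `i` and `k` exceed the length of every right-hand side, the
root rule can only be some `A → aᵖ B c^q` (`ncard_parses_threeBlocks`). So `(1 - M) f = 0` up to
series that vanish at large exponents, where `M` is a polynomial matrix over GF(2). Multiplying by
the adjugate, `D = det (1 - M)` sends each `f_A` to such a series (`det_smul_blockSeries_mem`).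

The constant term of `M` records the unit rules. Among nonterminals that derive some word and give
every word finitely many trees, these are acyclic, since a cycle would enlarge a tree without
changing its yield (`wellFounded_unitRule`). Hence `D` has nonzero constant term.

If the grammar described `{aⁿbⁿ⁺ᵐcᵐ}`, then at `j = 2N` the series of the initial nonterminal would
be supported on `i + k = 2N`. The coefficient of its product with `D` at exponents `(N, N)` would be
the constant term of `D` for every `N`, a contradiction. -/

namespace ParseForest

/-! ### Concatenating and splitting forests. -/

variable {T N : Type*}

/-- Concatenation of two sequences of trees. -/
def append : ParseForest T N → ParseForest T N → ParseForest T N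
  | nil, G => G
  | leaf t rest, G => leaf t (rest.append G)
  | node r children rest, G => node r children (rest.append G)

/-- The sequence of one-vertex trees labelled with the letters of a word. -/
def ofWord : List T → ParseForest T N
  | [] => nil
  | t :: w => leaf t (ofWord w)

theorem roots_append (F G : ParseForest T N) : (F.append G).roots = F.roots ++ G.roots := by
  induction F with
  | nil => rfl
  | leaf t rest ih => simp [append, roots, ih]
  | node r children rest _ ih => simp [append, roots, ih]

theorem yield_append (F G : ParseForest T N) : (F.append G).yield = F.yield ++ G.yield := by
  induction F with
  | nil => rfl
  | leaf t rest ih => simp [append, yield, ih]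
  | node r children rest _ ih => simp [append, yield, ih]

theorem wellFormed_append (R : Set (ContextFreeRule T N)) (F G : ParseForest T N) :
    (F.append G).WellFormed R ↔ F.WellFormed R ∧ G.WellFormed R := by
  induction F with
  | nil => simp [append, WellFormed]
  | leaf t rest ih => simp [append, WellFormed, ih]
  | node r children rest _ ih => simp [append, WellFormed, ih, and_assoc]

theorem append_right_injective (F : ParseForest T N) :
    Function.Injective (F.append : ParseForest T N → ParseForest T N) := by
  intro G H h
  induction F with
  | nil => exact h
  | leaf t rest ih => exact ih (by simpa [append] using h)
  | node r children rest _ ih => exact ih (by simpa [append] using h)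

theorem roots_ofWord (w : List T) :
    (ofWord w : ParseForest T N).roots = w.map Symbol.terminal := by
  induction w with
  | nil => rfl
  | cons t w ih => simp [ofWord, roots, ih]

theorem yield_ofWord (w : List T) : (ofWord w : ParseForest T N).yield = w := by
  induction w with
  | nil => rfl
  | cons t w ih => simp [ofWord, yield, ih]

theorem wellFormed_ofWord (R : Set (ContextFreeRule T N)) (w : List T) :
    (ofWord w).WellFormed R := by
  induction w with
  | nil => trivial
  | cons t w ih => exact ih

theorem eq_ofWord {w : List T} {F : ParseForest T N} (h : F.roots = w.map Symbol.terminal) :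
    F = ofWord w := by
  induction w generalizing F with
  | nil => cases F <;> simp_all [roots, ofWord]
  | cons t w ih =>
    cases F with
    | nil => simp [roots] at h
    | leaf s rest =>
      simp only [roots, List.map_cons, List.cons.injEq, Symbol.terminal.injEq] at h
      rw [ofWord, h.1, ih h.2]
    | node r c rest => simp [roots] at h

theorem exists_append_of_roots_eq {s₁ s₂ : List (Symbol T N)} {F : ParseForest T N}
    (h : F.roots = s₁ ++ s₂) : ∃ G H : ParseForest T N, F = G.append H ∧ G.roots = s₁ ∧ H.roots = s₂ := by
  induction s₁ generalizing F with
  | nil => exact ⟨nil, F, rfl, rfl, h⟩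
  | cons x s ih =>
    cases F with
    | nil => simp [roots] at h
    | leaf t rest =>
      simp only [roots, List.cons_append, List.cons.injEq] at h
      obtain ⟨G, H, rfl, hG, hH⟩ := ih h.2
      exact ⟨leaf t G, H, rfl, by simp [roots, hG, h.1], hH⟩
    | node r c rest =>
      simp only [roots, List.cons_append, List.cons.injEq] at h
      obtain ⟨G, H, rfl, hG, hH⟩ := ih h.2
      exact ⟨node r c G, H, rfl, by simp [roots, hG, h.1], hH⟩

theorem exists_node_of_roots_eq {A : N} {F : ParseForest T N}
    (h : F.roots = [Symbol.nonterminal A]) : ∃ r c, F = node r c nil ∧ r.input = A := by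
  cases F with
  | nil => simp [roots] at h
  | leaf t rest => simp [roots] at h
  | node r c rest =>
    simp only [roots, List.cons.injEq, Symbol.nonterminal.injEq] at h
    cases rest with
    | nil => exact ⟨r, c, rfl, h.1⟩
    | leaf t rest => simp [roots] at h
    | node r c rest => simp [roots] at h

/-! ### Counting parses of a sentential form. -/

/-- The well-formed sequences of trees over the rules `R` with roots `s` and with yield `w`. -/
def parses (R : Set (ContextFreeRule T N)) (s : List (Symbol T N)) (w : List T) :
    Set (ParseForest T N) :=
  {F | F.WellFormed R ∧ F.roots = s ∧ F.yield = w}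

variable (R : Set (ContextFreeRule T N))

theorem parses_map_terminal (u w : List T) [Decidable (u = w)] :
    parses R (u.map Symbol.terminal) w = if u = w then {ofWord u} else ∅ := by
  ext F
  split_ifs with h
  · subst h
    refine ⟨fun hF => eq_ofWord hF.2.1, ?_⟩
    rintro rfl
    exact ⟨wellFormed_ofWord _ _, roots_ofWord _, yield_ofWord _⟩
  · refine iff_of_false ?_ (by simp)
    rintro ⟨_, hr, hy⟩
    rw [eq_ofWord hr, yield_ofWord] at hy
    exact h hy

/-- Surrounding a sequence of trees by the leaves of two words. -/
def surround (u v : List T) (F : ParseForest T N) : ParseForest T N :=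
  (ofWord u).append (F.append (ofWord v))

/-- With a single root, the forest between the two words is one `node`, so constructor injectivity
replaces right cancellation. -/
theorem surround_injOn (u v : List T) (A : N) :
    Set.InjOn (surround u v) {F : ParseForest T N | F.roots = [Symbol.nonterminal A]} := by
  intro F hF G hG h
  obtain ⟨r, c, rfl, -⟩ := exists_node_of_roots_eq hF
  obtain ⟨r', c', rfl, -⟩ := exists_node_of_roots_eq hG
  have := append_right_injective _ h
  simp only [append, node.injEq] at this
  simp [this.1, this.2.1]

theorem surround_mem_parses {u v w : List T} {s : List (Symbol T N)} {F : ParseForest T N}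
    (hF : F ∈ parses R s w) : surround u v F ∈
      parses R (u.map Symbol.terminal ++ s ++ v.map Symbol.terminal) (u ++ w ++ v) := by
  refine ⟨?_, ?_, ?_⟩
  · simp [surround, wellFormed_append, wellFormed_ofWord, hF.1]
  · simp [surround, roots_append, roots_ofWord, hF.2.1]
  · simp [surround, yield_append, yield_ofWord, hF.2.2]

theorem exists_surround_of_mem_parses {u v w : List T} {s : List (Symbol T N)}
    {F : ParseForest T N}
    (hF : F ∈ parses R (u.map Symbol.terminal ++ s ++ v.map Symbol.terminal) w) :
    ∃ w', w = u ++ w' ++ v ∧ ∃ G ∈ parses R s w', F = surround u v G := by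
  obtain ⟨hw, hr, rfl⟩ := hF
  rw [List.append_assoc] at hr
  obtain ⟨F₁, F', rfl, h₁, h'⟩ := exists_append_of_roots_eq hr
  obtain ⟨G, F₂, rfl, hG, h₂⟩ := exists_append_of_roots_eq h'
  rw [eq_ofWord h₁, eq_ofWord h₂] at hw ⊢
  simp only [wellFormed_append] at hw
  refine ⟨G.yield, by simp [yield_append, yield_ofWord], G, ⟨hw.2.1, hG, rfl⟩, rfl⟩

theorem parses_surround (u v w : List T) (s : List (Symbol T N)) :
    parses R (u.map Symbol.terminal ++ s ++ v.map Symbol.terminal) (u ++ w ++ v) =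
      surround u v '' parses R s w := by
  ext F
  constructor
  · intro hF
    obtain ⟨w', hw, G, hG, rfl⟩ := exists_surround_of_mem_parses R hF
    simp only [List.append_cancel_right_eq, List.append_cancel_left_eq] at hw
    subst hw
    exact ⟨G, hG, rfl⟩
  · rintro ⟨G, hG, rfl⟩
    exact surround_mem_parses R hG

theorem ncard_parses_surround (u v w : List T) (A : N) :
    (parses R (u.map Symbol.terminal ++ [Symbol.nonterminal A] ++ v.map Symbol.terminal)
      (u ++ w ++ v)).ncard = (parses R [Symbol.nonterminal A] w).ncard := by
  rw [parses_surround]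
  exact ((surround_injOn u v A).mono fun F hF => hF.2.1).ncard_image

theorem node_mem_parses {r : ContextFreeRule T N} {c : ParseForest T N} {w : List T}
    (hr : r ∈ R) (hc : c ∈ parses R r.output w) :
    node r c nil ∈ parses R [Symbol.nonterminal r.input] w :=
  ⟨⟨hr, hc.2.1, hc.1, trivial⟩, rfl, by simp [yield, hc.2.2]⟩

theorem exists_node_of_mem_parses {A : N} {F : ParseForest T N} {w : List T}
    (hF : F ∈ parses R [Symbol.nonterminal A] w) :
    ∃ r ∈ R, r.input = A ∧ ∃ c ∈ parses R r.output w, F = node r c nil := by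
  obtain ⟨r, c, rfl, hr⟩ := exists_node_of_roots_eq hF.2.1
  obtain ⟨⟨h₁, h₂, h₃, -⟩, -, h₄⟩ := hF
  exact ⟨r, h₁, hr, c, ⟨h₃, h₂, by simpa [yield] using h₄⟩, rfl⟩

theorem node_nil_injective (r : ContextFreeRule T N) :
    Function.Injective fun c : ParseForest T N => node r c nil := by
  intro c c' h
  simpa using h

theorem finite_parses_output {r : ContextFreeRule T N} (hr : r ∈ R) {w : List T}
    (h : (parses R [Symbol.nonterminal r.input] w).Finite) : (parses R r.output w).Finite :=
  Set.Finite.of_injOn (fun _ hc => node_mem_parses R hr hc)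
    (node_nil_injective r).injOn h

/-- The parse trees of a word are classified by the rule applied at the root. -/
theorem ncard_parses_nonterminal [DecidableEq N] (R : Finset (ContextFreeRule T N)) (A : N)
    (w : List T) (h : (parses (R : Set _) [Symbol.nonterminal A] w).Finite) :
    (parses (R : Set _) [Symbol.nonterminal A] w).ncard =
      ∑ r ∈ R with r.input = A, (parses (R : Set _) r.output w).ncard := by
  classical
  have hfin : ∀ r : {r // r ∈ R.filter fun r => r.input = A},
      (parses (R : Set _) r.1.output w).Finite := by
    rintro ⟨r, hr⟩
    obtain ⟨hmem, rfl⟩ := Finset.mem_filter.1 hr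
    exact finite_parses_output _ (Finset.mem_coe.2 hmem) h
  have hunion : parses (R : Set _) [Symbol.nonterminal A] w =
      ↑((R.filter fun r => r.input = A).attach.biUnion fun r =>
        ((hfin r).toFinset.image fun c => node r.1 c nil)) := by
    ext F
    simp only [Finset.coe_biUnion, Set.mem_iUnion, Finset.mem_coe, Finset.mem_image,
      Set.Finite.mem_toFinset, Finset.mem_attach, exists_prop, true_and]
    constructor
    · intro hF
      obtain ⟨r, hr, hA, c, hc, rfl⟩ := exists_node_of_mem_parses _ hF
      exact ⟨⟨r, Finset.mem_filter.2 ⟨hr, hA⟩⟩, c, hc, rfl⟩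
    · rintro ⟨⟨r, hr⟩, c, hc, rfl⟩
      obtain ⟨hmem, rfl⟩ := Finset.mem_filter.1 hr
      exact node_mem_parses _ (Finset.mem_coe.2 hmem) hc
  rw [hunion, Set.ncard_coe_finset, Finset.card_biUnion]
  · rw [← Finset.sum_attach (R.filter _)]
    refine Finset.sum_congr rfl fun r _ => ?_
    rw [Finset.card_image_of_injective _ (node_nil_injective _),
      Set.ncard_eq_toFinset_card _ (hfin r)]
  · intro r _ r' _ hne
    rw [Function.onFun, Finset.disjoint_left]
    intro F hF hF'
    obtain ⟨c, -, rfl⟩ := Finset.mem_image.1 hF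
    obtain ⟨c', -, h⟩ := Finset.mem_image.1 hF'
    simp only [node.injEq, and_true] at h
    exact hne (Subtype.ext h.1.symm)

end ParseForest

/-! ### Words `aⁱbʲcᵏ` in a linear grammar. -/

namespace ParseForest

variable {T N : Type*}

/-- The word `aⁱbʲcᵏ`. -/
def threeBlocks (a b c : T) (i j k : ℕ) : List T :=
  List.replicate i a ++ List.replicate j b ++ List.replicate k c

theorem threeBlocks_eq_surround (a b c : T) {i k p q : ℕ} (j : ℕ) (hp : p ≤ i) (hq : q ≤ k) :
    threeBlocks a b c i j k =
      List.replicate p a ++ threeBlocks a b c (i - p) j (k - q) ++ List.replicate q c := by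
  obtain ⟨i, rfl⟩ := Nat.exists_eq_add_of_le hp
  obtain ⟨k, rfl⟩ := Nat.exists_eq_add_of_le' hq
  rw [Nat.add_sub_cancel_left, Nat.add_sub_cancel]
  simp only [threeBlocks, List.replicate_add, List.append_assoc]

/-- A short prefix lies inside the block of `a`, and a short suffix inside the block of `c`. -/
theorem eq_replicate_of_threeBlocks_eq {a b c : T} {i j k : ℕ} {u w v : List T}
    (h : threeBlocks a b c i j k = u ++ w ++ v) (hu : u.length ≤ i) (hv : v.length ≤ k) :
    u = List.replicate u.length a ∧ v = List.replicate v.length c := by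
  rw [threeBlocks_eq_surround a b c j hu hv, List.append_assoc, List.append_assoc] at h
  have h₁ := List.append_inj h (by simp)
  refine ⟨h₁.1.symm, ?_⟩
  exact (List.append_inj' h₁.2 (by simp)).2.symm

/-- A nonterminal that generates some word, and every word with finitely many parse trees. -/
def IsProper (R : Set (ContextFreeRule T N)) (A : N) : Prop :=
  (∀ w, (parses R [Symbol.nonterminal A] w).Finite) ∧
    ∃ w, (parses R [Symbol.nonterminal A] w).Nonempty

theorem finite_parses_of_rule {R : Set (ContextFreeRule T N)} {A B : N} {u v : List T}
    (hr : ⟨A, u.map Symbol.terminal ++ [Symbol.nonterminal B] ++ v.map Symbol.terminal⟩ ∈ R)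
    (hA : ∀ w, (parses R [Symbol.nonterminal A] w).Finite) (w : List T) :
    (parses R [Symbol.nonterminal B] w).Finite :=
  Set.Finite.of_injOn (fun _ hF => surround_mem_parses R hF)
    ((surround_injOn u v B).mono fun _ hF => hF.2.1)
    (finite_parses_output R hr (hA (u ++ w ++ v)))

/-- A nonterminal that derives a word is the left side of one of the finitely many rules. The type
`N` itself may be infinite, and the determinant needs a finite index set. -/
theorem finite_setOf_isProper (R : Finset (ContextFreeRule T N)) :
    {A | IsProper (R : Set (ContextFreeRule T N)) A}.Finite := by
  refine (R.finite_toSet.image ContextFreeRule.input).subset ?_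
  rintro A ⟨-, w, F, hF⟩
  obtain ⟨r, hr, hA, -⟩ := exists_node_of_mem_parses _ hF
  exact ⟨r, hr, hA⟩

/-- The linear rule `A → aᵖ B c^q`. -/
def blockRule (a c : T) (A B : N) (p q : ℕ) : ContextFreeRule T N :=
  ⟨A, (List.replicate p a).map Symbol.terminal ++ [Symbol.nonterminal B] ++
    (List.replicate q c).map Symbol.terminal⟩

theorem terminal_prefix_inj {s s' : List (Symbol T N)} {u u' : List T} {B B' : N}
    (h : u.map Symbol.terminal ++ Symbol.nonterminal B :: s =
      u'.map Symbol.terminal ++ Symbol.nonterminal B' :: s') : u = u' ∧ B = B' ∧ s = s' := by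
  induction u generalizing u' with
  | nil => cases u' <;> simp_all
  | cons t u ih =>
    cases u' with
    | nil => simp at h
    | cons t' u' =>
      simp only [List.map_cons, List.cons_append, List.cons.injEq, Symbol.terminal.injEq] at h
      obtain ⟨rfl, hB, hs⟩ := ih h.2
      exact ⟨by rw [h.1], hB, hs⟩

/-- The nonterminal separates the two terminal words, so this holds even if `a = c`. It makes the
sum over `(B, p, q)` count each rule once. -/
theorem blockRule_injective {a c : T} {A A' B B' : N} {p p' q q' : ℕ}
    (h : blockRule a c A B p q = blockRule a c A' B' p' q') : B = B' ∧ p = p' ∧ q = q' := by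
  simp only [blockRule, ContextFreeRule.mk.injEq, List.append_assoc, List.singleton_append] at h
  obtain ⟨h₁, h₂, h₃⟩ := terminal_prefix_inj h.2
  have h₁ := congrArg List.length h₁
  have h₃ := congrArg List.length h₃
  simp only [List.length_map, List.length_replicate] at h₁ h₃
  exact ⟨h₂, h₁, h₃⟩

open Classical in
/-- On long outer blocks, a linear grammar can only consume letters `a` on the left and letters `c`
on the right. -/
theorem ncard_parses_threeBlocks (R : Finset (ContextFreeRule T N))
    (hlin : ∀ r ∈ R, (∃ w : List T, r.output = w.map Symbol.terminal) ∨
      ∃ (u v : List T) (B : N),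
        r.output = u.map Symbol.terminal ++ [Symbol.nonterminal B] ++ v.map Symbol.terminal)
    {l : ℕ} (hl : ∀ r ∈ R, r.output.length < l)
    [Fintype {A // IsProper (R : Set (ContextFreeRule T N)) A}]
    {A : N} (hA : IsProper (R : Set (ContextFreeRule T N)) A) (a b c : T) {i k : ℕ} (j : ℕ) (hi : l ≤ i) (hk : l ≤ k) :
    (parses (R : Set _) [Symbol.nonterminal A] (threeBlocks a b c i j k)).ncard =
      ∑ B : {A // IsProper (R : Set (ContextFreeRule T N)) A},
        ∑ p ∈ Finset.range l, ∑ q ∈ Finset.range l,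
          if blockRule a c A B.1 p q ∈ R then
            (parses (R : Set _) [Symbol.nonterminal B.1]
              (threeBlocks a b c (i - p) j (k - q))).ncard
          else 0 := by
  simp_rw [← Finset.sum_product']
  rw [← Finset.sum_filter, ncard_parses_nonterminal R A _ (hA.1 _)]
  symm
  refine Finset.sum_of_injOn (fun x => blockRule a c A x.1.1 x.2.1 x.2.2) ?_ ?_ ?_ ?_
  · rintro ⟨B, p, q⟩ - ⟨B', p', q'⟩ - h
    obtain ⟨h₁, h₂, h₃⟩ := blockRule_injective h
    exact Prod.ext (Subtype.ext h₁) (Prod.ext h₂ h₃)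
  · rintro ⟨B, p, q⟩ hx
    simp only [Finset.coe_filter, Set.mem_ofPred_eq] at hx ⊢
    exact ⟨hx.2, rfl⟩
  -- Rules outside the image contribute nothing: a terminal rule yields too short a word, and a rule
  -- `A → u B v` that contributes has `u = aᵖ` and `v = c^q`, with `B` again proper.
  · rintro ⟨A', s⟩ hr hx
    replace hr := Finset.mem_filter.1 hr
    obtain rfl : A' = A := hr.2
    replace hr := hr.1
    have hlen := hl _ hr
    simp only at hlen ⊢
    by_contra hne
    obtain ⟨F, hF⟩ := Set.nonempty_of_ncard_ne_zero hne
    obtain ⟨w, rfl⟩ | ⟨u, v, B, rfl⟩ := hlin _ hr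
    · rw [parses_map_terminal] at hF
      split_ifs at hF with hw
      · subst hw
        simp [threeBlocks] at hlen
        omega
      · exact hF
    · obtain ⟨w, hw, G, hG, rfl⟩ := exists_surround_of_mem_parses _ hF
      simp only [List.length_append, List.length_map, List.length_singleton] at hlen
      obtain ⟨hu, hv⟩ := eq_replicate_of_threeBlocks_eq hw (by omega) (by omega)
      refine hx ⟨⟨⟨B, finite_parses_of_rule hr hA.1, w, G, hG⟩, u.length, v.length⟩, ?_, ?_⟩
      · simp only [Finset.coe_filter, Set.mem_ofPred_eq, Finset.mem_product, Finset.mem_univ,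
          Finset.mem_range, true_and]
        refine ⟨⟨by omega, by omega⟩, ?_⟩
        rw [blockRule, ← hu, ← hv]
        exact hr
      · simp only [blockRule, ← hu, ← hv]
  · rintro ⟨B, p, q⟩ hx
    simp only [Finset.mem_filter, Finset.mem_product, Finset.mem_univ, true_and,
      Finset.mem_range] at hx
    rw [threeBlocks_eq_surround a b c j (show p ≤ i by omega) (show q ≤ k by omega)]
    exact (ncard_parses_surround _ _ _ _ _).symm

/-- Unit rules between proper nonterminals are acyclic. -/
theorem wellFounded_unitRule (R : Set (ContextFreeRule T N))
    [Finite {A // IsProper R A}] :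
    WellFounded fun B A : {A // IsProper R A} => ⟨A.1, [Symbol.nonterminal B.1]⟩ ∈ R := by
  set E := fun B A : {A // IsProper R A} => (⟨A.1, [Symbol.nonterminal B.1]⟩ : ContextFreeRule T N) ∈ R
  have grow : ∀ {B A}, Relation.TransGen E B A → ∀ w, ∀ F ∈ parses R [Symbol.nonterminal B.1] w,
      ∃ G ∈ parses R [Symbol.nonterminal A.1] w, sizeOf F < sizeOf G := by
    have step : ∀ {B A}, E B A → ∀ w, ∀ F ∈ parses R [Symbol.nonterminal B.1] w,
        ∃ G ∈ parses R [Symbol.nonterminal A.1] w, sizeOf F < sizeOf G := by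
      intro B A h w F hF
      exact ⟨_, node_mem_parses R h hF, by simp⟩
    intro B A h w F hF
    induction h with
    | single h => exact step h w F hF
    | tail _ h ih =>
      obtain ⟨G, hG, hlt⟩ := ih
      obtain ⟨H, hH, hlt'⟩ := step h w G hG
      exact ⟨H, hH, hlt.trans hlt'⟩
  -- On a cycle through `A`, a largest tree of a word derived from `A` could be enlarged. Properness
  -- supplies the word and the finiteness.
  have : Std.Irrefl (Relation.TransGen E) := ⟨fun A h => by
    obtain ⟨w, hw⟩ := A.2.2
    obtain ⟨F, hF, hmax⟩ := Set.exists_max_image _ sizeOf (A.2.1 w) hw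
    obtain ⟨G, hG, hlt⟩ := grow h w F hF
    exact (hmax G hG).not_gt hlt⟩
  exact Subrelation.wf (fun h => Relation.TransGen.single h)
    (Finite.wellFounded_of_trans_of_irrefl (Relation.TransGen E))

end ParseForest

/-! ### Determinants and linear systems. -/

/-- If `M v` has entries in a submodule `W`, then so has `det M • v`. -/
theorem Submodule.det_smul_mem {R V ι : Type*} [CommRing R] [AddCommGroup V] [Module R V]
    [Fintype ι] [DecidableEq ι] (W : Submodule R V) (M : Matrix ι ι R) (v : ι → V)
    (h : ∀ i, ∑ j, M i j • v j ∈ W) (i : ι) : M.det • v i ∈ W := by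
  have key : M.det • v i = ∑ k, M.adjugate i k • ∑ j, M k j • v j := by
    calc M.det • v i = ∑ j, (M.adjugate * M) i j • v j := by
          simp [Matrix.adjugate_mul, Matrix.one_apply]
      _ = _ := by
          simp_rw [Matrix.mul_apply, Finset.sum_smul, Finset.smul_sum, mul_smul]
          exact Finset.sum_comm
  rw [key]
  exact W.sum_mem fun k _ => W.smul_mem _ (h k)

/-- Let `M` be a matrix over an integral domain whose nonzero entries lie along a well-founded relation;
then `1 - M` is nonsingular. -/
theorem Matrix.det_one_sub_ne_zero_of_wellFounded {K ι : Type*} [CommRing K] [IsDomain K]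
    [Fintype ι] [DecidableEq ι] {E : ι → ι → Prop} (hE : WellFounded E) (M : Matrix ι ι K)
    (hM : ∀ i j, M i j ≠ 0 → E j i) : (1 - M).det ≠ 0 := by
  intro h
  obtain ⟨v, hv, h0⟩ := Matrix.exists_mulVec_eq_zero_iff.2 h
  -- A kernel vector satisfies `v = M v`, so each entry vanishes once all its `E`-predecessors do.
  refine hv (funext fun i => ?_)
  induction i using hE.induction with
  | _ i ih =>
    have := congrFun h0 i
    rw [Matrix.sub_mulVec, Matrix.one_mulVec, Pi.sub_apply, Pi.zero_apply, sub_eq_zero] at this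
    rw [this, Pi.zero_apply]
    refine Finset.sum_eq_zero fun j _ => ?_
    by_cases hij : M i j = 0
    · simp [hij]
    · simp [ih j (hM i j hij)]

/-! ### Power series vanishing at large exponents. -/

namespace MvPowerSeries

variable {σ R A : Type*} [CommRing R] [CommRing A] [Algebra R A]

theorem coeff_mvPolynomial_smul [DecidableEq σ] (q : MvPolynomial σ R) (f : MvPowerSeries σ A)
    (n : σ →₀ ℕ) :
    coeff n (q • f) = ∑ x ∈ Finset.HasAntidiagonal.antidiagonal n, q.coeff x.1 • coeff x.2 f := by
  rw [Algebra.smul_def, algebraMap_apply', coeff_mul]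
  simp [Algebra.smul_def]

theorem coeff_monomial_smul (m n : σ →₀ ℕ) (f : MvPowerSeries σ A) [Decidable (m ≤ n)] :
    coeff n (MvPolynomial.monomial m (1 : R) • f) = if m ≤ n then coeff (n - m) f else 0 := by
  classical
  rw [Algebra.smul_def, algebraMap_apply', MvPolynomial.coe_monomial, map_monomial,
    coeff_monomial_mul]
  simp

variable (R A σ) in
/-- The power series whose coefficients vanish when all exponents are large enough. -/
def vanishingOnLarge : Submodule (MvPolynomial σ R) (MvPowerSeries σ A) where
  carrier := {f | ∃ l : ℕ, ∀ n : σ →₀ ℕ, (∀ i, l ≤ n i) → coeff n f = 0}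
  zero_mem' := ⟨0, fun _ _ => by simp⟩
  add_mem' := by
    rintro f g ⟨l, hl⟩ ⟨m, hm⟩
    refine ⟨max l m, fun n hn => ?_⟩
    rw [map_add, hl n fun i => (le_max_left _ _).trans (hn i),
      hm n fun i => (le_max_right _ _).trans (hn i), add_zero]
  smul_mem' := by
    classical
    rintro q f ⟨l, hl⟩
    -- Removing an exponent in the support of `q` lowers each coordinate by at most `q.totalDegree`.
    refine ⟨q.totalDegree + l, fun n hn => ?_⟩
    rw [coeff_mvPolynomial_smul]
    refine Finset.sum_eq_zero fun x hx => ?_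
    rw [Finset.HasAntidiagonal.mem_antidiagonal] at hx
    by_cases hq : q.coeff x.1 = 0
    · simp [hq]
    · rw [hl x.2, smul_zero]
      intro i
      have h₁ : x.1 i ≤ q.totalDegree :=
        (Finsupp.le_degree i x.1).trans (MvPolynomial.le_totalDegree (MvPolynomial.mem_support_iff.2 hq))
      have h₂ := hn i
      rw [← hx, Finsupp.add_apply] at h₂
      omega

end MvPowerSeries

/-! ### The linear system for the parity series. -/

namespace ParseForest

variable {T N : Type*}

theorem threeBlocks_injective {a b c : T} (hab : a ≠ b) (hac : a ≠ c) (hbc : b ≠ c)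
    {i j k i' j' k' : ℕ} (h : threeBlocks a b c i j k = threeBlocks a b c i' j' k') :
    i = i' ∧ j = j' ∧ k = k' := by
  classical
  refine ⟨?_, ?_, ?_⟩
  · simpa [threeBlocks, List.count_replicate, hab.symm, hac.symm] using congrArg (List.count a) h
  · simpa [threeBlocks, List.count_replicate, hab, hbc.symm] using congrArg (List.count b) h
  · simpa [threeBlocks, List.count_replicate, hac, hbc] using congrArg (List.count c) h

open MvPowerSeries

/-- The monomial exponent `xᵖzᵠ`. -/
noncomputable def biexponent (p q : ℕ) : Fin 2 →₀ ℕ := Finsupp.single 0 p + Finsupp.single 1 q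

@[simp] theorem biexponent_zero (p q : ℕ) : biexponent p q 0 = p := by simp [biexponent]

@[simp] theorem biexponent_one (p q : ℕ) : biexponent p q 1 = q := by simp [biexponent]

theorem biexponent_le {p q : ℕ} {n : Fin 2 →₀ ℕ} : biexponent p q ≤ n ↔ p ≤ n 0 ∧ q ≤ n 1 := by
  simp [Finsupp.le_def, Fin.forall_fin_two]

/-- The parity of the number of parse trees for the words `aⁱbʲcᵏ`, as a power series in the
numbers `i` and `k`, with coefficients that depend on `j`. -/
noncomputable def blockSeries (R : Set (ContextFreeRule T N)) (a b c : T) (A : N) :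
    MvPowerSeries (Fin 2) (ℕ → ZMod 2) := fun n j =>
  (parses R [Symbol.nonterminal A] (threeBlocks a b c (n 0) j (n 1))).ncard

theorem coeff_blockSeries (R : Set (ContextFreeRule T N)) (a b c : T) (A : N) (n : Fin 2 →₀ ℕ)
    (j : ℕ) : coeff n (blockSeries R a b c A) j =
      (parses R [Symbol.nonterminal A] (threeBlocks a b c (n 0) j (n 1))).ncard := rfl

open Classical in
/-- The matrix of the rules `A → aᵖ B c^q` with `p, q < l`. -/
noncomputable def blockMatrix (R : Finset (ContextFreeRule T N)) (a c : T) (l : ℕ) :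
    Matrix {A // IsProper (R : Set (ContextFreeRule T N)) A}
      {A // IsProper (R : Set (ContextFreeRule T N)) A} (MvPolynomial (Fin 2) (ZMod 2)) :=
  fun A B => ∑ p ∈ Finset.range l, ∑ q ∈ Finset.range l,
    if blockRule a c A.1 B.1 p q ∈ R then MvPolynomial.monomial (biexponent p q) 1 else 0

-- Only `p = q = 0` survives in the constant term, which leaves the well-founded relation of unit
-- rules.
open Classical in
theorem constantCoeff_det_one_sub_blockMatrix (R : Finset (ContextFreeRule T N)) (a c : T) (l : ℕ)
    [Fintype {A // IsProper (R : Set (ContextFreeRule T N)) A}] :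
    MvPolynomial.constantCoeff (1 - blockMatrix R a c l).det ≠ 0 := by
  rw [RingHom.map_det, map_sub, map_one]
  refine Matrix.det_one_sub_ne_zero_of_wellFounded (wellFounded_unitRule _) _ fun A B h => ?_
  rw [RingHom.mapMatrix_apply, Matrix.map_apply, blockMatrix, map_sum] at h
  obtain ⟨p, -, h⟩ := Finset.exists_ne_zero_of_sum_ne_zero h
  rw [map_sum] at h
  obtain ⟨q, -, h⟩ := Finset.exists_ne_zero_of_sum_ne_zero h
  split_ifs at h with hr
  · rw [MvPolynomial.constantCoeff_monomial] at h
    have h0 : biexponent p q = 0 := by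
      by_contra hne
      simp [hne] at h
    obtain rfl : p = 0 := by simpa using DFunLike.congr_fun h0 0
    obtain rfl : q = 0 := by simpa using DFunLike.congr_fun h0 1
    simpa [blockRule] using hr
  · simp at h

open Classical in
theorem det_smul_blockSeries_mem (R : Finset (ContextFreeRule T N))
    (hlin : ∀ r ∈ R, (∃ w : List T, r.output = w.map Symbol.terminal) ∨
      ∃ (u v : List T) (B : N),
        r.output = u.map Symbol.terminal ++ [Symbol.nonterminal B] ++ v.map Symbol.terminal)
    {l : ℕ} (hl : ∀ r ∈ R, r.output.length < l)
    [Fintype {A // IsProper (R : Set (ContextFreeRule T N)) A}] (a b c : T)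
    (A : {A // IsProper (R : Set (ContextFreeRule T N)) A}) :
    (1 - blockMatrix R a c l).det • blockSeries (R : Set (ContextFreeRule T N)) a b c A.1 ∈
      vanishingOnLarge (Fin 2) (ZMod 2) (ℕ → ZMod 2) := by
  refine Submodule.det_smul_mem _ _
    (fun A : {A // IsProper (R : Set (ContextFreeRule T N)) A} =>
      blockSeries (R : Set (ContextFreeRule T N)) a b c A.1) (fun A => ?_) A
  refine ⟨l, fun n hn => ?_⟩
  simp only [Matrix.sub_apply, sub_smul, Finset.sum_sub_distrib, Matrix.one_apply, ite_smul,
    one_smul, zero_smul, Finset.sum_ite_eq, Finset.mem_univ, if_true, map_sub, sub_eq_zero,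
    map_sum, blockMatrix, Finset.sum_smul]
  funext j
  rw [coeff_blockSeries, ncard_parses_threeBlocks R hlin hl A.2 a b c j (hn 0) (hn 1)]
  simp only [Finset.sum_apply, Nat.cast_sum]
  refine Finset.sum_congr rfl fun B _ => Finset.sum_congr rfl fun p hp =>
    Finset.sum_congr rfl fun q hq => ?_
  rw [Finset.mem_range] at hp hq
  split_ifs with hr
  · rw [coeff_monomial_smul, if_pos (biexponent_le.2 ⟨hp.le.trans (hn 0), hq.le.trans (hn 1)⟩),
      coeff_blockSeries]
    simp
  · simp

end ParseForest

/-! ### The contradiction for `{aⁿbⁿ⁺ᵐcᵐ}`. -/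

/-- The language `{aⁿbⁿ⁺ᵐcᵐ}` is not described by a linear GF(2)-grammar. -/
theorem Language.not_isLinearGF2_threeBlocks {T : Type*} {a b c : T} (hab : a ≠ b) (hac : a ≠ c)
    (hbc : b ≠ c) {L : Language T}
    (hL : ∀ w, w ∈ L ↔ ∃ n m, w = ParseForest.threeBlocks a b c n (n + m) m) :
    ¬ L.IsLinearGF2 := by
  classical
  open ParseForest MvPowerSeries in
  rintro ⟨g, hlin, hfin, rfl⟩
  have hmem : ∀ i j k, Odd (parses (g.rules : Set (ContextFreeRule T g.NT))
      [Symbol.nonterminal g.initial] (threeBlocks a b c i j k)).ncard ↔ j = i + k := by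
    intro i j k
    refine (hL _).trans ⟨?_, fun h => ⟨i, k, by rw [h]⟩⟩
    rintro ⟨n, m, h⟩
    obtain ⟨rfl, rfl, rfl⟩ := threeBlocks_injective hab hac hbc h
    rfl
  have hS : IsProper (g.rules : Set (ContextFreeRule T g.NT)) g.initial :=
    ⟨hfin, _, Set.nonempty_of_ncard_ne_zero ((hmem 0 0 0).2 rfl).pos.ne'⟩
  have : Fintype {A // IsProper (g.rules : Set (ContextFreeRule T g.NT)) A} :=
    (finite_setOf_isProper g.rules).fintype
  have hl : ∀ r ∈ g.rules, r.output.length < g.rules.sup (fun r => r.output.length) + 1 :=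
    fun r hr => Nat.lt_succ_of_le (Finset.le_sup (f := fun r => r.output.length) hr)
  obtain ⟨N, hN⟩ := det_smul_blockSeries_mem g.rules hlin hl a b c ⟨_, hS⟩
  have h0 := constantCoeff_det_one_sub_blockMatrix g.rules a c
    (g.rules.sup (fun r => r.output.length) + 1)
  -- The middle block has length `N + N`, so a nonzero shift of `(N, N)` by a monomial of the
  -- determinant leaves the support `i + k = N + N`.
  have h1 := congrFun (hN (biexponent N N) (by simp [Fin.forall_fin_two])) (N + N)
  rw [coeff_mvPolynomial_smul, Finset.sum_apply,
    Finset.sum_eq_single (0, biexponent N N)] at h1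
  · rw [Pi.smul_apply, coeff_blockSeries, biexponent_zero, biexponent_one,
      ZMod.natCast_eq_one_iff_odd.2 ((hmem _ _ _).2 rfl)] at h1
    exact h0 (by simpa [MvPolynomial.constantCoeff_eq] using h1)
  · rintro ⟨s, t⟩ hst hne
    rw [Finset.HasAntidiagonal.mem_antidiagonal] at hst
    have e0 := DFunLike.congr_fun hst 0
    have e1 := DFunLike.congr_fun hst 1
    simp only [Finsupp.add_apply, biexponent_zero, biexponent_one] at e0 e1
    have hz : ((parses (g.rules : Set (ContextFreeRule T g.NT)) [Symbol.nonterminal g.initial]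
        (threeBlocks a b c (t 0) (N + N) (t 1))).ncard : ZMod 2) = 0 := by
      rw [ZMod.natCast_eq_zero_iff_even, ← Nat.not_odd_iff_even, hmem]
      intro h
      refine hne (Prod.ext ?_ ?_)
      · ext i
        fin_cases i <;> simp <;> omega
      · ext i
        fin_cases i <;> simp <;> omega
    rw [Pi.smul_apply, coeff_blockSeries, hz, smul_zero]
  · intro h
    exact absurd (Finset.HasAntidiagonal.mem_antidiagonal.2 (zero_add _)) h

/-! ### Parse trees versus derivations, and the grammar of `{aⁿbⁿ}`. -/

namespace ContextFreeGrammar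

open ParseForest

variable {T : Type*}

theorem derives_of_wellFormed (g : ContextFreeGrammar T) (F : ParseForest T g.NT)
    (hF : F.WellFormed {r | r ∈ g.rules}) :
    g.Derives F.roots (F.yield.map Symbol.terminal) := by
  induction F with
  | nil => exact Derives.refl _
  | leaf t rest ih => exact (ih hF).append_left [Symbol.terminal t]
  | node r c rest ihc ihr =>
    obtain ⟨hr, hc, hc', hrest⟩ := hF
    have h : g.Produces ([Symbol.nonterminal r.input] ++ rest.roots) (r.output ++ rest.roots) :=
      ⟨r, hr, ContextFreeRule.Rewrites.head _⟩
    rw [yield, List.map_append]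
    refine h.trans_derives ?_
    rw [← hc]
    exact ((ihc hc').append_right _).trans ((ihr hrest).append_left _)

/-- Induction from the first rewriting step: the trees over the rewritten segment are gathered under
a new root. -/
theorem exists_forest_of_derives (g : ContextFreeGrammar T) {s : List (Symbol T g.NT)}
    {w : List T} (h : g.Derives s (w.map Symbol.terminal)) :
    (parses {r | r ∈ g.rules} s w).Nonempty := by
  induction h using Relation.ReflTransGen.head_induction_on with
  | refl => exact ⟨ofWord w, wellFormed_ofWord _ _, roots_ofWord _, yield_ofWord _⟩
  | head h _ ih =>
    obtain ⟨r, hr, hrw⟩ := h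
    obtain ⟨p, q, rfl, rfl⟩ := hrw.exists_parts
    obtain ⟨F, hF, hroots, rfl⟩ := ih
    obtain ⟨F', F₃, rfl, h', h₃⟩ := exists_append_of_roots_eq hroots
    obtain ⟨F₁, F₂, rfl, h₁, h₂⟩ := exists_append_of_roots_eq h'
    simp only [wellFormed_append] at hF
    refine ⟨F₁.append (node r F₂ F₃), ?_, ?_, ?_⟩
    · exact (wellFormed_append _ _ _).2 ⟨hF.1.1, hr, h₂, hF.1.2, hF.2⟩
    · simp [roots_append, roots, h₁, h₃]
    · simp [yield_append, yield]

theorem mem_language_iff_parseTrees_nonempty (g : ContextFreeGrammar T) (w : List T) :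
    w ∈ g.language ↔ (g.parseTrees w).Nonempty := by
  rw [mem_language_iff]
  refine ⟨g.exists_forest_of_derives, ?_⟩
  rintro ⟨F, hF, hr, rfl⟩
  rw [← hr]
  exact g.derives_of_wellFormed F hF

/-- The recursive rule `S → a S b`. -/
def wrapRule (a b : T) : ContextFreeRule T Unit :=
  ⟨(), [Symbol.terminal a, Symbol.nonterminal (), Symbol.terminal b]⟩

open Classical in
/-- The grammar `S → a S b | ε`. -/
noncomputable def anbnGrammar (a b : T) : ContextFreeGrammar T :=
  ⟨Unit, (), {wrapRule a b, ⟨(), []⟩}⟩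

open Classical in
theorem mem_rules_anbnGrammar {a b : T} {r : ContextFreeRule T Unit} :
    r ∈ (anbnGrammar a b).rules ↔ r = wrapRule a b ∨ r = ⟨(), []⟩ := by
  change r ∈ ({wrapRule a b, ⟨(), []⟩} : Finset (ContextFreeRule T Unit)) ↔ _
  simp

/-- The parse tree of `aⁿbⁿ`. -/
def anbnTree (a b : T) : ℕ → ParseForest T Unit
  | 0 => node ⟨(), []⟩ nil nil
  | n + 1 => node (wrapRule a b) (surround [a] [b] (anbnTree a b n)) nil

theorem replicate_append_succ (a b : T) (n : ℕ) :
    List.replicate (n + 1) a ++ List.replicate (n + 1) b =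
      [a] ++ (List.replicate n a ++ List.replicate n b) ++ [b] := by
  rw [List.replicate_succ, List.replicate_succ']
  simp

theorem anbnTree_mem (a b : T) (n : ℕ) : anbnTree a b n ∈
    (anbnGrammar a b).parseTrees (List.replicate n a ++ List.replicate n b) := by
  induction n with
  | zero => exact ⟨⟨mem_rules_anbnGrammar.2 (.inr rfl), rfl, trivial, trivial⟩, rfl, rfl⟩
  | succ n ih =>
    rw [replicate_append_succ]
    exact node_mem_parses (r := wrapRule a b) _ (mem_rules_anbnGrammar.2 (.inl rfl))
      (surround_mem_parses _ (u := [a]) (v := [b]) ih)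

/-- This gives both the language and unambiguity, since the length of `w` determines `n`. -/
theorem eq_anbnTree (a b : T) {w : List T} {F : ParseForest T Unit}
    (hF : F ∈ (anbnGrammar a b).parseTrees w) :
    ∃ n, w = List.replicate n a ++ List.replicate n b ∧ F = anbnTree a b n := by
  classical
  induction hw : w.length using Nat.strong_induction_on generalizing w F with
  | _ l ih =>
    obtain ⟨r, hr, -, c, hc, rfl⟩ := exists_node_of_mem_parses _ hF
    obtain rfl | rfl := mem_rules_anbnGrammar.1 hr
    · obtain ⟨w, rfl, G, hG, rfl⟩ := exists_surround_of_mem_parses _ (u := [a]) (v := [b])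
        (s := [Symbol.nonterminal ()]) hc
      obtain ⟨n, rfl, rfl⟩ := ih w.length (by simp [← hw]) hG rfl
      exact ⟨n + 1, (replicate_append_succ a b n).symm, rfl⟩
    · have h := hc
      change c ∈ parses _ (([] : List T).map Symbol.terminal) w at h
      rw [parses_map_terminal] at h
      split_ifs at h with h0
      · exact ⟨0, h0.symm, by rw [Set.mem_singleton_iff.1 h]; rfl⟩
      · exact h.elim

end ContextFreeGrammar

/-! ### The two factors and their GF(2)-concatenation. -/

namespace Language

open ContextFreeGrammar

variable {T : Type*}

theorem isUnambiguousLinear_anbn (a b : T) : (anbn a b).IsUnambiguousLinear := by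
  refine ⟨anbnGrammar a b, ?_, ?_, ?_⟩
  · intro r hr
    obtain rfl | rfl := mem_rules_anbnGrammar.1 hr
    · exact .inr ⟨[a], [b], (), rfl⟩
    · exact .inl ⟨[], rfl⟩
  · intro w F hF G hG
    obtain ⟨n, rfl, rfl⟩ := eq_anbnTree a b hF
    obtain ⟨m, hm, rfl⟩ := eq_anbnTree a b hG
    have h := congrArg List.length hm
    simp only [List.length_append, List.length_replicate] at h
    obtain rfl : n = m := by omega
    rfl
  · ext w
    rw [mem_language_iff_parseTrees_nonempty]
    constructor
    · rintro ⟨F, hF⟩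
      obtain ⟨n, hn, -⟩ := eq_anbnTree a b hF
      exact ⟨n, hn⟩
    · rintro ⟨n, rfl⟩
      exact ⟨_, anbnTree_mem a b n⟩

/-- With at most one tree per word, an odd count is the same as existence of a tree. -/
theorem IsUnambiguousLinear.isLinearGF2 {L : Language T} (h : L.IsUnambiguousLinear) :
    L.IsLinearGF2 := by
  obtain ⟨g, hlin, hun, rfl⟩ := h
  refine ⟨g, hlin, fun w => (hun w).finite, ?_⟩
  ext w
  rw [mem_language_iff_parseTrees_nonempty]
  refine ⟨fun h => Set.nonempty_of_ncard_ne_zero (Odd.pos h).ne', ?_⟩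
  rintro ⟨F, hF⟩
  change Odd (g.parseTrees w).ncard
  rw [(hun w).eq_singleton_of_mem hF, Set.ncard_singleton]
  exact odd_one

theorem gf2Concat_anbn {a b c : T} (hab : a ≠ b) (hac : a ≠ c) (hbc : b ≠ c) :
    gf2Concat (anbn a b) (anbn b c) =
      {w : List T | ∃ n m : ℕ,
        w = List.replicate n a ++ List.replicate (n + m) b ++ List.replicate m c} := by
  have happ : ∀ n m : ℕ, (List.replicate n a ++ List.replicate n b) ++
      (List.replicate m b ++ List.replicate m c) = ParseForest.threeBlocks a b c n (n + m) m := by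
    intro n m
    simp only [ParseForest.threeBlocks, List.replicate_add, List.append_assoc]
  ext w
  constructor
  · intro h
    obtain ⟨⟨u, v⟩, ⟨n, rfl⟩, ⟨m, rfl⟩, rfl⟩ := Set.nonempty_of_ncard_ne_zero (Odd.pos h).ne'
    exact ⟨n, m, happ n m⟩
  · rintro ⟨n, m, rfl⟩
    change Odd (Set.ncard _)
    -- The factorization is unique: the blocks of `a` and `c` determine `n` and `m`.
    rw [Set.ncard_eq_one.2 ⟨(List.replicate n a ++ List.replicate n b,
      List.replicate m b ++ List.replicate m c), ?_⟩]
    · exact odd_one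
    · ext ⟨u, v⟩
      constructor
      · rintro ⟨⟨n', rfl⟩, ⟨m', rfl⟩, h⟩
        obtain ⟨rfl, -, rfl⟩ :=
          ParseForest.threeBlocks_injective hab hac hbc ((happ n' m').symm.trans h)
        rfl
      · rintro h
        obtain ⟨rfl, rfl⟩ := Prod.mk.inj h
        exact ⟨⟨n, rfl⟩, ⟨m, rfl⟩, happ n m⟩

end Language

theorem theorem5p1 {T : Type*} (a b c : T) (hab : a ≠ b) (hac : a ≠ c) (hbc : b ≠ c) :
    -- `{aⁿbⁿ}` and `{bᵐcᵐ}` are unambiguous linear languages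
    (Language.anbn a b).IsUnambiguousLinear ∧
    (Language.anbn b c).IsUnambiguousLinear ∧
    -- their GF(2)-concatenation is `{aⁿbⁿ⁺ᵐcᵐ}`
    Language.gf2Concat (Language.anbn a b) (Language.anbn b c) =
      {w : List T | ∃ n m : ℕ,
        w = List.replicate n a ++ List.replicate (n + m) b ++ List.replicate m c} ∧
    -- which is not described by any linear GF(2)-grammar
    ¬ (Language.gf2Concat (Language.anbn a b) (Language.anbn b c)).IsLinearGF2 ∧
    -- so the languages described by linear GF(2)-grammars are not closed under GF(2)-concatenation
    ¬ (∀ K L : Language T, K.IsLinearGF2 → L.IsLinearGF2 → (Language.gf2Concat K L).IsLinearGF2) := by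
  have hnot : ¬ (Language.gf2Concat (Language.anbn a b) (Language.anbn b c)).IsLinearGF2 :=
    Language.not_isLinearGF2_threeBlocks hab hac hbc fun w => by
      rw [Language.gf2Concat_anbn hab hac hbc]
      rfl
  exact ⟨Language.isUnambiguousLinear_anbn a b, Language.isUnambiguousLinear_anbn b c,
    Language.gf2Concat_anbn hab hac hbc, hnot, fun h => hnot
      (h _ _ (Language.isUnambiguousLinear_anbn a b).isLinearGF2
        (Language.isUnambiguousLinear_anbn b c).isLinearGF2)⟩
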